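/- All spaces are weak Hausdorff $k$-spaces, and products and quotients are taken in that category. A *flow* $X$ consists of a set $X^0$ of states, a space $\mathbb{P}_{\alpha,\beta}X$ of execution paths for all $\alpha,\beta\in X^0$, and continuous associative composition laws $*:\mathbb{P}_{\alpha,\beta}X\times\mathbb{P}_{\beta,\gamma}X\to\mathbb{P}_{\alpha,\gamma}X$; put $\mathbb{P}X=\bigsqcup_{\alpha,\beta}\mathbb{P}_{\alpha,\beta}X$. A morphism $f:X\to Y$ is a map $f^0:X^0\to Y^0$ with continuous maps $\mathbb{P}_{\alpha,\beta}X\to\mathbb{P}_{f^0(\alpha),f^0(\beta)}Y$ compatible with $*$. For a space $Z$, $\mathrm{Glob}(Z)$ is the flow with two states $\widehat 0,\widehat 1$, with $\mathbb{P}_{\widehat 0,\widehat 1}=Z$ and no other path. The *directed segment* is $\vec I=\mathrm{Glob}(\{u\})$. The tensor product has $(X\otimes Y)^0=X^0\times Y^0$ and $\mathbb{P}(X\otimes Y)=(\mathbb{P}X\times\mathbb{P}Y)\sqcup(X^0\times\mathbb{P}Y)\sqcup(\mathbb{P}X\times Y^0)$, with componentwise source, target and composition, states being treated as constant paths. Let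 $\mathrm{cell}(\mathrm{Flow})$ be the class of flows $X$ such that $\varnothing\to X$ is a transfinite composition of pushouts of the morphisms $\mathrm{Glob}(\mathbf S^{k-1})\subset\mathrm{Glob}(\mathbf D^k)$ ($k\ge 0$), $\{0,1\}\to\{0\}$ and $\varnothing\to\{0\}$ (sets being viewed as flows without paths). A morphism $f$ is a *weak S-homotopy equivalence* if $f^0$ is bijective and $\mathbb{P}f:\mathbb{P}X\to\mathbb{P}Y$ is a weak homotopy equivalence. It is an *S-homotopy equivalence* if there is a morphism $g:Y\to X$ such that $g f$ and $f g$ are S-homotopic to the identities, where two morphisms are S-homotopic if they are joined by a family $(H_t)_{t\in[0,1]}$ of morphisms of flows, constant on states and jointly continuous on $[0,1]\times\mathbb{P}$. A *full $n$-cube* $\vec C_n=Q(\vec I^{\otimes n})$ is a cofibrant replacement of $\vec I^{\otimes n}$, that is, an object of $\mathrm{cell}(\mathrm{Flow})$ with a weak S-homotopy equivalence to $\vec I^{\otimes n}$. For a state $\alpha$ of $Y$, let $\mathbb{P}^-_\alpha Y$ (resp. $\mathbb{P}^+_\alpha Y$) be the quotient of the space of paths starting from (resp. ending at) $\alpha$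 by the identifications $x=x*y$ (resp. $x=y*x$). A morphism $f:X\to Y$ between objects of $\mathrm{cell}(\mathrm{Flow})$ is a *T-homotopy equivalence* if (1) $f$ induces an isomorphism from $X$ to the restriction of $Y$ to the set of states $f^0(X^0)$; (2) for every $\alpha\in Y^0\setminus f^0(X^0)$, the spaces $\mathbb{P}^-_\alpha Y$ and $\mathbb{P}^+_\alpha Y$ are singletons; (3) for every $\alpha\in Y^0\setminus f^0(X^0)$ there are a path from a state of $f^0(X^0)$ to $\alpha$ and a path from $\alpha$ to a state of $f^0(X^0)$. **Theorem.** Let $n\ge 3$ and let $\vec C_n$ be a full $n$-cube. There do not exist an integer $m\ge 0$ and a zig-zag of morphisms of flows $$\vec C_n=X_0\xrightarrow{f_0}X_1\xleftarrow{f_1}X_2\xrightarrow{f_2}\cdots\xleftarrow{f_{2m-1}}X_{2m}=\vec I$$ in which every $X_i$ is an object of $\mathrm{cell}(\mathrm{Flow})$ and every $f_i$ is an S-homotopy equivalence or a T-homotopy equivalence. -/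

import Mathlib

open CategoryTheory

universe u

/-! ### Compactly generated spaces

Spaces are weak Hausdorff `k`-spaces. `CompactlyGeneratedSpace` is Mathlib's notion of a `k`-space:
the topology is the final one for all continuous maps from compact Hausdorff spaces. -/

/-- `X` is weak Hausdorff: the image of every continuous map from a compact Hausdorff space
to `X` is closed. -/
class WeaklyHausdorffSpace (X : Type u) [TopologicalSpace X] : Prop where
  isClosed_range : ∀ (K : Type u) [TopologicalSpace K] [CompactSpace K] [T2Space K] (f : K → X),
    Continuous f → IsClosed (Set.range f)

/-- The product in the category of compactly generated spaces: the set `A × B` with the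
`k`-ification of the product topology. -/
@[ext]
structure KProd (A B : Type u) : Type u where
  fst : A
  snd : B

instance (A B : Type u) [TopologicalSpace A] [TopologicalSpace B] :
    TopologicalSpace (KProd A B) :=
  (TopologicalSpace.compactlyGenerated.{u} (A × B)).coinduced fun p => ⟨p.1, p.2⟩

section Topology

variable {A B C D : Type u} [TopologicalSpace A] [TopologicalSpace B] [TopologicalSpace C]
  [TopologicalSpace D]

theorem WeaklyHausdorffSpace.of_t2 [T2Space A] : WeaklyHausdorffSpace A :=
  ⟨fun _ _ _ _ _ hf => (isCompact_range hf).isClosed⟩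

theorem KProd.continuous_of_compact {m : KProd A B → C}
    (h : ∀ (K : Type u) [TopologicalSpace K] [CompactSpace K] [T2Space K] (f : K → A) (g : K → B),
      Continuous f → Continuous g → Continuous (fun k => m ⟨f k, g k⟩)) : Continuous m := by
  refine continuous_coinduced_dom.2 ?_
  exact continuous_from_compactlyGenerated.{u} (X := A × B) _
    fun S g => h S (fun k => (g k).1) (fun k => (g k).2) (by fun_prop) (by fun_prop)

theorem KProd.continuous_mk {K : Type u} [TopologicalSpace K] [CompactlyGeneratedSpace K]
    {f : K → A} {g : K → B} (hf : Continuous f) (hg : Continuous g) :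
    Continuous (fun k => (⟨f k, g k⟩ : KProd A B)) := by
  refine continuous_from_uCompactlyGeneratedSpace.{u} _ fun S j => ?_
  have h0 : @Continuous _ _ inferInstance (TopologicalSpace.compactlyGenerated.{u} (A × B))
      (fun p : (Σ (i : (S : CompHaus.{u}) × C(S, A × B)), i.fst) => p.1.2 p.2) :=
    continuous_coinduced_rng
  have h1 : Continuous (fun p : (Σ (i : (S : CompHaus.{u}) × C(S, A × B)), i.fst) =>
      (⟨(p.1.2 p.2).1, (p.1.2 p.2).2⟩ : KProd A B)) :=
    continuous_iff_coinduced_le.2 (by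
      have := coinduced_mono (f := fun p : A × B => (⟨p.1, p.2⟩ : KProd A B))
        (continuous_iff_coinduced_le.1 h0)
      rwa [coinduced_compose] at this)
  exact h1.comp (continuous_sigmaMk (σ := fun i : (S : CompHaus.{u}) × C(S, A × B) => i.fst)
    (i := ⟨S, ⟨fun k => (f (j k), g (j k)), by fun_prop⟩⟩))

theorem KProd.continuous_fst : Continuous (fun p : KProd A B => p.fst) :=
  KProd.continuous_of_compact fun _ _ _ _ _ _ hf _ => hf

theorem KProd.continuous_snd : Continuous (fun p : KProd A B => p.snd) :=
  KProd.continuous_of_compact fun _ _ _ _ _ _ _ hg => hg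

instance : CompactlyGeneratedSpace (KProd A B) := by
  refine uCompactlyGeneratedSpace_of_continuous_maps.{u} fun {Y} _ m h => ?_
  refine KProd.continuous_of_compact fun K _ _ _ f g hf hg => ?_
  exact h (CompHaus.of K) ⟨fun k => ⟨f k, g k⟩, KProd.continuous_mk hf hg⟩

/-- In a weak Hausdorff space, the image of a compact Hausdorff space is Hausdorff. -/
theorem WeaklyHausdorffSpace.t2_range [WeaklyHausdorffSpace A] {K : Type u} [TopologicalSpace K]
    [CompactSpace K] [T2Space K] {f : K → A} (hf : Continuous f) : T2Space (Set.range f) := by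
  have hcl : ∀ s : Set K, IsClosed s → IsClosed (f '' s) := by
    intro s hs
    have : CompactSpace s := isCompact_iff_compactSpace.1 hs.isCompact
    have := WeaklyHausdorffSpace.isClosed_range (X := A) s (fun x => f x)
      (hf.comp continuous_subtype_val)
    rwa [Set.range_comp' f, Subtype.range_coe] at this
  have hpt : ∀ a : A, IsClosed (f ⁻¹' {a}) := by
    intro a
    by_cases h : a ∈ Set.range f
    · obtain ⟨k, rfl⟩ := h
      have := hcl {k} isClosed_singleton
      rw [Set.image_singleton] at this
      exact this.preimage hf
    · have : f ⁻¹' {a} = ∅ := by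
        ext k
        simp only [Set.mem_preimage, Set.mem_singleton_iff, Set.mem_empty_iff_false, iff_false]
        exact fun e => h ⟨k, e⟩
      rw [this]
      exact isClosed_empty
  refine ⟨fun x y hxy => ?_⟩
  have hd : Disjoint (f ⁻¹' {x.1}) (f ⁻¹' {y.1}) := by
    rw [Set.disjoint_left]
    intro k h1 h2
    exact hxy (Subtype.ext (h1.symm.trans h2))
  obtain ⟨U, V, hU, hV, hxU, hyV, hUV⟩ := normal_separation (hpt x.1) (hpt y.1) hd
  refine ⟨Subtype.val ⁻¹' (f '' Uᶜ)ᶜ, Subtype.val ⁻¹' (f '' Vᶜ)ᶜ,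
    (hcl _ hU.isClosed_compl).isOpen_compl.preimage continuous_subtype_val,
    (hcl _ hV.isClosed_compl).isOpen_compl.preimage continuous_subtype_val, ?_, ?_, ?_⟩
  · rintro ⟨k, hk, e⟩
    exact hk (hxU e)
  · rintro ⟨k, hk, e⟩
    exact hk (hyV e)
  · rw [Set.disjoint_left]
    rintro ⟨_, k, rfl⟩ h1 h2
    have h1' : k ∈ U := by
      by_contra h
      exact h1 ⟨k, h, rfl⟩
    have h2' : k ∈ V := by
      by_contra h
      exact h2 ⟨k, h, rfl⟩
    exact Set.disjoint_left.1 hUV h1' h2'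

instance [WeaklyHausdorffSpace A] [WeaklyHausdorffSpace B] :
    WeaklyHausdorffSpace (KProd A B) := by
  refine ⟨fun K _ _ _ f hf => ?_⟩
  have h1 : Continuous (fun k => (f k).fst) := KProd.continuous_fst.comp hf
  have h2 : Continuous (fun k => (f k).snd) := KProd.continuous_snd.comp hf
  have := WeaklyHausdorffSpace.t2_range h1
  have := WeaklyHausdorffSpace.t2_range h2
  have hc1 := WeaklyHausdorffSpace.isClosed_range K _ h1
  have hc2 := WeaklyHausdorffSpace.isClosed_range K _ h2
  let g : K → Set.range (fun k => (f k).fst) × Set.range (fun k => (f k).snd) :=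
    fun k => (⟨(f k).fst, k, rfl⟩, ⟨(f k).snd, k, rfl⟩)
  have hg : Continuous g := (h1.subtype_mk _).prodMk (h2.subtype_mk _)
  have hgc : IsClosed (Set.range g) := (isCompact_range hg).isClosed
  have he : Topology.IsClosedEmbedding
      (Prod.map Subtype.val Subtype.val :
        Set.range (fun k => (f k).fst) × Set.range (fun k => (f k).snd) → A × B) :=
    hc1.isClosedEmbedding_subtypeVal.prodMap hc2.isClosedEmbedding_subtypeVal
  have hfin := (he.isClosedMap _ hgc).preimage
    (KProd.continuous_fst.prodMk (KProd.continuous_snd (A := A) (B := B)))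
  convert hfin using 1
  ext p
  constructor
  · rintro ⟨k, rfl⟩
    exact ⟨g k, ⟨k, rfl⟩, rfl⟩
  · rintro ⟨_, ⟨k, rfl⟩, h⟩
    exact ⟨k, KProd.ext (congrArg Prod.fst h) (congrArg Prod.snd h)⟩

theorem WeaklyHausdorffSpace.of_isClopen_cover
    (h : ∀ a : A, ∃ (X : Type u) (_ : TopologicalSpace X) (_ : WeaklyHausdorffSpace X) (e : X → A),
      Topology.IsOpenEmbedding e ∧ IsClosed (Set.range e) ∧ a ∈ Set.range e) :
    WeaklyHausdorffSpace A := by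
  refine ⟨fun K _ _ _ f hf => ?_⟩
  rw [← isOpen_compl_iff, isOpen_iff_mem_nhds]
  intro a ha
  obtain ⟨X, _, _, e, he, hcl, x, rfl⟩ := h a
  let K' := f ⁻¹' Set.range e
  have : CompactSpace K' := isCompact_iff_compactSpace.1 (hcl.preimage hf).isCompact
  choose g hg using fun k : K' => k.2
  have hgc : Continuous g := by
    rw [he.isEmbedding.continuous_iff]
    have : e ∘ g = fun k : K' => f k := funext hg
    rw [this]
    exact hf.comp continuous_subtype_val
  have hcl := WeaklyHausdorffSpace.isClosed_range K' g hgc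
  have hx : x ∈ (Set.range g)ᶜ := by
    rintro ⟨k, rfl⟩
    exact ha ⟨k.1, (hg k).symm⟩
  refine Filter.mem_of_superset (he.isOpenMap.image_mem_nhds (hcl.isOpen_compl.mem_nhds hx)) ?_
  rintro _ ⟨y, hy, rfl⟩ ⟨k, hk⟩
  exact hy ⟨⟨k, ⟨y, hk.symm⟩⟩, he.injective ((hg _).trans hk)⟩

instance {p : Prop} {X : PLift p → Type u} [∀ i, TopologicalSpace (X i)]
    [∀ i, WeaklyHausdorffSpace (X i)] : WeaklyHausdorffSpace (Σ i, X i) :=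
  .of_isClopen_cover fun a => ⟨X a.1, inferInstance, inferInstance, Sigma.mk a.1,
    Topology.IsOpenEmbedding.sigmaMk, Topology.IsClosedEmbedding.sigmaMk.isClosed_range, a.2, rfl⟩

instance [WeaklyHausdorffSpace A] [WeaklyHausdorffSpace B] : WeaklyHausdorffSpace (A ⊕ B) :=
  .of_isClopen_cover fun x => match x with
    | .inl a => ⟨A, inferInstance, inferInstance, Sum.inl, Topology.IsOpenEmbedding.inl,
        isClosed_range_inl, a, rfl⟩
    | .inr b => ⟨B, inferInstance, inferInstance, Sum.inr, Topology.IsOpenEmbedding.inr,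
        isClosed_range_inr, b, rfl⟩

/-- `m` is continuous on the product of compactly generated spaces: it is continuous along every
pair of continuous maps from a compact Hausdorff space. -/
def KContinuous₂ (m : A → B → C) : Prop :=
  ∀ (K : Type u) [TopologicalSpace K] [CompactSpace K] [T2Space K] (f : K → A) (g : K → B),
    Continuous f → Continuous g → Continuous (fun k => m (f k) (g k))

theorem KContinuous₂.flip {m : A → B → C} (h : KContinuous₂ m) :
    KContinuous₂ (fun b a => m a b) :=
  fun K _ _ _ f g hf hg => h K g f hg hf

theorem KContinuous₂.continuous {m : A → B → C} (h : KContinuous₂ m) :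
    Continuous (fun p : KProd A B => m p.fst p.snd) :=
  KProd.continuous_of_compact h

theorem KContinuous₂.of_continuous {m : A → B → C}
    (h : Continuous (fun p : KProd A B => m p.fst p.snd)) : KContinuous₂ m :=
  fun _ _ _ _ _ _ hf hg => h.comp (KProd.continuous_mk hf hg)

theorem KContinuous₂.of_cover {m : A → B → C}
    (h : ∀ a : A, ∃ (X : Type u) (_ : TopologicalSpace X) (e : X → A),
      Topology.IsOpenEmbedding e ∧ IsClosed (Set.range e) ∧ a ∈ Set.range e ∧
        KContinuous₂ (fun x => m (e x))) : KContinuous₂ m := by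
  intro K _ _ _ f g hf hg
  rw [continuous_iff_continuousAt]
  intro k
  obtain ⟨X, _, e, he, hcl, hk, h⟩ := h (f k)
  let K' := f ⁻¹' Set.range e
  have : CompactSpace K' := isCompact_iff_compactSpace.1 (hcl.preimage hf).isCompact
  choose l hl using fun k : K' => k.2
  have hlc : Continuous l := by
    rw [he.isEmbedding.continuous_iff]
    have : e ∘ l = fun k : K' => f k := funext hl
    rw [this]
    exact hf.comp continuous_subtype_val
  have hc := h K' l (fun k => g k) hlc (hg.comp continuous_subtype_val)
  simp only [hl] at hc
  have hK' : IsOpen K' := he.isOpen_range.preimage hf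
  have hco : ContinuousOn (fun k => m (f k) (g k)) K' :=
    continuousOn_iff_continuous_domRestrict.2 hc
  exact hco.continuousAt (hK'.mem_nhds hk)

theorem KContinuous₂.sum {m : A ⊕ B → C → D} (h1 : KContinuous₂ (fun a => m (.inl a)))
    (h2 : KContinuous₂ (fun b => m (.inr b))) : KContinuous₂ m :=
  .of_cover fun x => match x with
    | .inl a => ⟨A, inferInstance, Sum.inl, Topology.IsOpenEmbedding.inl,
        isClosed_range_inl, ⟨a, rfl⟩, h1⟩
    | .inr b => ⟨B, inferInstance, Sum.inr, Topology.IsOpenEmbedding.inr,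
        isClosed_range_inr, ⟨b, rfl⟩, h2⟩

theorem KContinuous₂.sigma {p : Prop} {X : PLift p → Type u} [∀ i, TopologicalSpace (X i)]
    {m : (Σ i, X i) → C → D} (h : ∀ i, KContinuous₂ (fun x => m ⟨i, x⟩)) : KContinuous₂ m :=
  .of_cover fun a => ⟨X a.1, inferInstance, Sigma.mk a.1, Topology.IsOpenEmbedding.sigmaMk,
    Topology.IsClosedEmbedding.sigmaMk.isClosed_range, ⟨a.2, rfl⟩, h a.1⟩

end Topology

theorem continuous_of_isEmpty {A B : Type u} {_ : TopologicalSpace A} {_ : TopologicalSpace B}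
    (h : A → False) (f : A → B) : Continuous f :=
  continuous_iff_continuousAt.2 fun a => (h a).elim

/-! ### Flows -/

/-- A flow: a set of states, for each pair of states a compactly generated space of
(nonconstant) execution paths, and a continuous associative composition law. -/
structure PathFlow : Type (u + 1) where
  /-- the `0`-skeleton -/
  State : Type u
  /-- the execution paths from one state to another -/
  Path : State → State → Type u
  [top : ∀ a b, TopologicalSpace (Path a b)]
  [cg : ∀ a b, CompactlyGeneratedSpace (Path a b)]
  [wh : ∀ a b, WeaklyHausdorffSpace (Path a b)]
  /-- the composition law `x * y` -/
  comp : ∀ {a b c}, Path a b → Path b c → Path a c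
  continuous_comp : ∀ a b c, Continuous
    (fun p : KProd (Path a b) (Path b c) => comp p.fst p.snd)
  assoc : ∀ {a b c d} (x : Path a b) (y : Path b c) (z : Path c d),
    comp (comp x y) z = comp x (comp y z)

namespace PathFlow

attribute [instance] PathFlow.top PathFlow.cg PathFlow.wh

/-- A morphism of flows. -/
@[ext]
structure Hom (X Y : PathFlow.{u}) : Type u where
  state : X.State → Y.State
  path : ∀ {a b}, X.Path a b → Y.Path (state a) (state b)
  continuous_path : ∀ a b, Continuous (path : X.Path a b → Y.Path (state a) (state b))
  map_comp : ∀ {a b c} (x : X.Path a b) (y : X.Path b c),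
    path (X.comp x y) = Y.comp (path x) (path y)

instance : Category PathFlow.{u} where
  Hom := Hom
  id X := ⟨id, id, fun _ _ => continuous_id, fun _ _ => rfl⟩
  comp f g := ⟨g.state ∘ f.state, g.path ∘ f.path,
    fun _ _ => (g.continuous_path _ _).comp (f.continuous_path _ _),
    fun x y => by simp only [Function.comp_apply, f.map_comp, g.map_comp]⟩

/-- The path space `ℙX`: the disjoint union of all the spaces of paths. -/
abbrev PathSpace (X : PathFlow.{u}) : Type u := Σ p : X.State × X.State, X.Path p.1 p.2

/-- The continuous map `ℙf : ℙX → ℙY`. -/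
def Hom.onPaths {X Y : PathFlow.{u}} (f : X ⟶ Y) : C(X.PathSpace, Y.PathSpace) where
  toFun x := ⟨(Hom.state f x.1.1, Hom.state f x.1.2), Hom.path f x.2⟩
  continuous_toFun := continuous_sigma fun i => (continuous_sigmaMk
    (σ := fun p : Y.State × Y.State => Y.Path p.1 p.2)
    (i := (Hom.state f i.1, Hom.state f i.2))).comp (Hom.continuous_path f i.1 i.2)

/-- The set `S` viewed as a flow without execution paths. -/
def discrete (S : Type u) : PathFlow.{u} where
  State := S
  Path _ _ := PEmpty
  wh _ _ := .of_t2
  comp x _ := x.elim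
  continuous_comp _ _ _ := KProd.continuous_of_compact fun _ _ _ _ f _ _ _ =>
    continuous_iff_continuousAt.2 fun k => (f k).elim
  assoc x _ _ := x.elim

/-- A set map, viewed as a morphism of flows without execution paths. -/
def discreteMap {S T : Type u} (f : S → T) : discrete S ⟶ discrete T :=
  Hom.mk (X := discrete S) (Y := discrete T) f (fun x => x.elim)
    (fun _ _ => continuous_of_isEmpty (fun k => k.elim) _) (fun x _ => x.elim)

/-- The initial object: the flow without any state. -/
def empty : PathFlow.{u} := discrete PEmpty

/-- The unique morphism from the initial object. -/
def fromEmpty (X : PathFlow.{u}) : empty ⟶ X :=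
  Hom.mk (X := empty) (Y := X) PEmpty.elim (fun x => x.elim)
    (fun _ _ => continuous_of_isEmpty (fun k => k.elim) _) (fun x _ => x.elim)

/-! ### Globes -/

/-- The two states of a globe. -/
inductive GlobState : Type u
  | bot
  | top

/-- The execution paths of `Glob(Z)`: `Z` from the bottom state to the top one, and nothing else. -/
def GlobPath (Z : Type u) : GlobState.{u} → GlobState.{u} → Type u
  | .bot, .top => Z
  | .bot, .bot => PEmpty
  | .top, _ => PEmpty

instance (Z : Type u) [TopologicalSpace Z] : ∀ a b, TopologicalSpace (GlobPath Z a b)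
  | .bot, .top => inferInstanceAs (TopologicalSpace Z)
  | .bot, .bot => inferInstanceAs (TopologicalSpace PEmpty)
  | .top, _ => inferInstanceAs (TopologicalSpace PEmpty)

instance (Z : Type u) [TopologicalSpace Z] [CompactlyGeneratedSpace Z] :
    ∀ a b, CompactlyGeneratedSpace (GlobPath Z a b)
  | .bot, .top => inferInstanceAs (CompactlyGeneratedSpace Z)
  | .bot, .bot => inferInstanceAs (CompactlyGeneratedSpace PEmpty)
  | .top, _ => inferInstanceAs (CompactlyGeneratedSpace PEmpty)

instance (Z : Type u) [TopologicalSpace Z] [WeaklyHausdorffSpace Z] :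
    ∀ a b, WeaklyHausdorffSpace (GlobPath Z a b)
  | .bot, .top => inferInstanceAs (WeaklyHausdorffSpace Z)
  | .bot, .bot => WeaklyHausdorffSpace.of_t2 (A := PEmpty)
  | .top, _ => WeaklyHausdorffSpace.of_t2 (A := PEmpty)

theorem GlobPath.not_composable {Z : Type u} : ∀ {a b c : GlobState.{u}},
    GlobPath Z a b → GlobPath Z b c → False
  | .bot, .top, _, _, y => PEmpty.elim y
  | .bot, .bot, _, x, _ => PEmpty.elim x
  | .top, _, _, x, _ => PEmpty.elim x

/-- The globe `Glob(Z)`. No two of its execution paths are composable. -/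
def glob (Z : Type u) [TopologicalSpace Z] [CompactlyGeneratedSpace Z] [WeaklyHausdorffSpace Z] :
    PathFlow.{u} where
  State := GlobState
  Path := GlobPath Z
  comp x y := (GlobPath.not_composable x y).elim
  continuous_comp _ _ _ := KProd.continuous_of_compact fun _ _ _ _ f g _ _ =>
    continuous_iff_continuousAt.2 fun k => (GlobPath.not_composable (f k) (g k)).elim
  assoc x y _ := (GlobPath.not_composable x y).elim

/-- The action of `Glob` on the execution paths. -/
def GlobPath.map {Z W : Type u} (φ : Z → W) : ∀ {a b}, GlobPath Z a b → GlobPath W a b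
  | .bot, .top, z => φ z
  | .bot, .bot, x => PEmpty.elim x
  | .top, _, x => PEmpty.elim x

/-- The morphism `Glob(φ)`. -/
def globMap {Z W : Type u} [TopologicalSpace Z] [CompactlyGeneratedSpace Z]
    [WeaklyHausdorffSpace Z] [TopologicalSpace W] [CompactlyGeneratedSpace W]
    [WeaklyHausdorffSpace W] (φ : C(Z, W)) : glob Z ⟶ glob W :=
  Hom.mk (X := glob Z) (Y := glob W) id (fun x => GlobPath.map φ x)
    (fun a b => match a, b with
      | .bot, .top => φ.continuous
      | .bot, .bot => continuous_of_isEmpty (fun k => PEmpty.elim k) _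
      | .top, _ => continuous_of_isEmpty (fun k => PEmpty.elim k) _)
    (fun x y => (GlobPath.not_composable x y).elim)

/-- The directed segment. -/
def segment : PathFlow.{u} :=
  haveI : WeaklyHausdorffSpace PUnit.{u + 1} := .of_t2
  glob PUnit

/-! ### The tensor product -/

/-- The paths of `X ⊗ Y` from `(a, b)` to `(c, d)`: pairs of paths, pairs (constant path, path) and
pairs (path, constant path). -/
abbrev TensorPath (X Y : PathFlow.{u}) (a : X.State) (b : Y.State) (c : X.State) (d : Y.State) :
    Type u :=
  KProd (X.Path a c) (Y.Path b d) ⊕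
    ((Σ _ : PLift (a = c), Y.Path b d) ⊕ (Σ _ : PLift (b = d), X.Path a c))

/-- Componentwise composition, where constant paths are neutral. -/
def tensorComp (X Y : PathFlow.{u}) {a c e : X.State} {b d f : Y.State} :
    TensorPath X Y a b c d → TensorPath X Y c d e f → TensorPath X Y a b e f
  | .inl x, .inl y => .inl ⟨X.comp x.fst y.fst, Y.comp x.snd y.snd⟩
  | .inl x, .inr (.inl ⟨⟨h⟩, y⟩) => .inl ⟨h ▸ x.fst, Y.comp x.snd y⟩
  | .inl x, .inr (.inr ⟨⟨h⟩, y⟩) => .inl ⟨X.comp x.fst y, h ▸ x.snd⟩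
  | .inr (.inl ⟨⟨h⟩, x⟩), .inl y => .inl ⟨h ▸ y.fst, Y.comp x y.snd⟩
  | .inr (.inl ⟨⟨h⟩, x⟩), .inr (.inl ⟨⟨h₁⟩, y⟩) => .inr (.inl ⟨⟨h.trans h₁⟩, Y.comp x y⟩)
  | .inr (.inl ⟨⟨h⟩, x⟩), .inr (.inr ⟨⟨h₁⟩, y⟩) => .inl ⟨h ▸ y, h₁ ▸ x⟩
  | .inr (.inr ⟨⟨h⟩, x⟩), .inl y => .inl ⟨X.comp x y.fst, h ▸ y.snd⟩
  | .inr (.inr ⟨⟨h⟩, x⟩), .inr (.inl ⟨⟨h₁⟩, y⟩) => .inl ⟨h₁ ▸ x, h ▸ y⟩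
  | .inr (.inr ⟨⟨h⟩, x⟩), .inr (.inr ⟨⟨h₁⟩, y⟩) => .inr (.inr ⟨⟨h.trans h₁⟩, X.comp x y⟩)

theorem kContinuous_comp (X : PathFlow.{u}) (a b c : X.State) :
    KContinuous₂ (fun (x : X.Path a b) (y : X.Path b c) => X.comp x y) :=
  .of_continuous (X.continuous_comp a b c)

theorem kContinuous_tensorComp (X Y : PathFlow.{u}) (a c e : X.State) (b d f : Y.State) :
    KContinuous₂ (fun (x : TensorPath X Y a b c d) (y : TensorPath X Y c d e f) =>
      tensorComp X Y x y) := by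
  have hX := X.kContinuous_comp
  have hY := Y.kContinuous_comp
  have f1 {A B : Type u} [TopologicalSpace A] [TopologicalSpace B] {K : Type u}
    [TopologicalSpace K] {f : K → KProd A B} (hf : Continuous f) :
    Continuous fun k => (f k).fst := KProd.continuous_fst.comp hf
  have f2 {A B : Type u} [TopologicalSpace A] [TopologicalSpace B] {K : Type u}
    [TopologicalSpace K] {f : K → KProd A B} (hf : Continuous f) :
    Continuous fun k => (f k).snd := KProd.continuous_snd.comp hf
  refine .sum (KContinuous₂.flip (.sum ?_ (.sum (.sigma ?_) (.sigma ?_))))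
    (.sum (.sigma ?_) (.sigma ?_))
  · intro K _ _ _ f g hf hg
    exact continuous_inl.comp (KProd.continuous_mk (hX _ _ _ K _ _ (f1 hg) (f1 hf))
      (hY _ _ _ K _ _ (f2 hg) (f2 hf)))
  · rintro ⟨h⟩
    subst h
    intro K _ _ _ f g hf hg
    exact continuous_inl.comp (KProd.continuous_mk (f1 hg) (hY _ _ _ K _ _ (f2 hg) hf))
  · rintro ⟨h⟩
    subst h
    intro K _ _ _ f g hf hg
    exact continuous_inl.comp (KProd.continuous_mk (hX _ _ _ K _ _ (f1 hg) hf) (f2 hg))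
  · rintro ⟨h⟩
    subst h
    refine KContinuous₂.flip (.sum ?_ (.sum (.sigma ?_) (.sigma ?_)))
    · intro K _ _ _ f g hf hg
      exact continuous_inl.comp (KProd.continuous_mk (f1 hf) (hY _ _ _ K _ _ hg (f2 hf)))
    · rintro ⟨h⟩
      intro K _ _ _ f g hf hg
      exact continuous_inr.comp (continuous_inl.comp
        (continuous_sigmaMk.comp (hY _ _ _ K _ _ hg hf)))
    · rintro ⟨h⟩
      subst h
      intro K _ _ _ f g hf hg
      exact continuous_inl.comp (KProd.continuous_mk hf hg)
  · rintro ⟨h⟩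
    subst h
    refine KContinuous₂.flip (.sum ?_ (.sum (.sigma ?_) (.sigma ?_)))
    · intro K _ _ _ f g hf hg
      exact continuous_inl.comp (KProd.continuous_mk (hX _ _ _ K _ _ hg (f1 hf)) (f2 hf))
    · rintro ⟨h⟩
      subst h
      intro K _ _ _ f g hf hg
      exact continuous_inl.comp (KProd.continuous_mk hg hf)
    · rintro ⟨h⟩
      intro K _ _ _ f g hf hg
      exact continuous_inr.comp (continuous_inr.comp
        (continuous_sigmaMk.comp (hX _ _ _ K _ _ hg hf)))

theorem tensorComp_assoc (X Y : PathFlow.{u}) {a c e g : X.State} {b d f h : Y.State}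
    (x : TensorPath X Y a b c d) (y : TensorPath X Y c d e f) (z : TensorPath X Y e f g h) :
    tensorComp X Y (tensorComp X Y x y) z = tensorComp X Y x (tensorComp X Y y z) := by
  rcases x with x | ⟨⟨hx⟩, x⟩ | ⟨⟨hx⟩, x⟩ <;> rcases y with y | ⟨⟨hy⟩, y⟩ | ⟨⟨hy⟩, y⟩ <;>
    rcases z with z | ⟨⟨hz⟩, z⟩ | ⟨⟨hz⟩, z⟩ <;> subst_vars <;>
    simp only [tensorComp, X.assoc, Y.assoc]

/-- The tensor product of two flows. -/
def tensor (X Y : PathFlow.{u}) : PathFlow.{u} where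
  State := X.State × Y.State
  Path p q := TensorPath X Y p.1 p.2 q.1 q.2
  comp := tensorComp X Y
  continuous_comp p q r := (kContinuous_tensorComp X Y p.1 q.1 r.1 p.2 q.2 r.2).continuous
  assoc := tensorComp_assoc X Y

/-- The `n`-fold tensor power of the directed segment; for `n = 0` it is the unit of the tensor
product, the flow with one state and no execution path. -/
def segmentPow : ℕ → PathFlow.{u}
  | 0 => discrete PUnit
  | n + 1 => tensor (segmentPow n) segment

/-! ### Cell complexes -/

instance (n : ℕ) : T2Space (TopCat.disk.{u} n) :=
  inferInstanceAs (T2Space (ULift (Metric.closedBall (0 : EuclideanSpace ℝ (Fin n)) 1)))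

instance (n : ℕ) : T2Space (TopCat.diskBoundary.{u} n) :=
  inferInstanceAs (T2Space (ULift (Metric.sphere (0 : EuclideanSpace ℝ (Fin n)) 1)))

instance (n : ℕ) : WeaklyHausdorffSpace (TopCat.disk.{u} n) := .of_t2

instance (n : ℕ) : WeaklyHausdorffSpace (TopCat.diskBoundary.{u} n) := .of_t2

/-- The generating cofibrations: `Glob(Sⁿ⁻¹) ⊂ Glob(Dⁿ)` for `n ≥ 0`, `R : {0, 1} → {0}` and
`C : ∅ → {0}`. -/
inductive GeneratingCofibration : MorphismProperty PathFlow.{u}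
  | globe (n : ℕ) : GeneratingCofibration (globMap (TopCat.diskBoundaryInclusion.{u} n).hom)
  | collapse : GeneratingCofibration
      (discreteMap (fun _ => PUnit.unit : ULift.{u} Bool → PUnit.{u + 1}))
  | point : GeneratingCofibration (discreteMap (PEmpty.elim : PEmpty.{u + 1} → PUnit.{u + 1}))

/-- `X` is an object of `cell(Flow)`: the morphism `∅ ⟶ X` is a transfinite composition of pushouts
of generating cofibrations. -/
def IsCell (X : PathFlow.{u}) : Prop :=
  MorphismProperty.transfiniteCompositions.{u} GeneratingCofibration.pushouts (fromEmpty X)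

end PathFlow

/-! ### Weak homotopy equivalences -/

/-- The map induced by `f` on path components. -/
def ContinuousMap.onZerothHomotopy {A B : Type u} [TopologicalSpace A] [TopologicalSpace B]
    (f : C(A, B)) : ZerothHomotopy A → ZerothHomotopy B :=
  Quotient.map f fun _ _ h => h.map f.continuous

/-- The map induced by `f` on `πₙ`. -/
def ContinuousMap.onHomotopyGroup {A B : Type u} [TopologicalSpace A] [TopologicalSpace B]
    (f : C(A, B)) (n : ℕ) (a : A) : HomotopyGroup.Pi n A a → HomotopyGroup.Pi n B (f a) :=
  Quotient.map (fun p : GenLoop (Fin n) A a =>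
      (⟨f.comp p.1, fun y hy => congrArg f (p.2 y hy)⟩ : GenLoop (Fin n) B (f a)))
    fun _ _ h => ContinuousMap.HomotopicRel.comp_continuousMap h f

/-- `f` induces a bijection on path components and isomorphisms on all homotopy groups at all
base points. -/
def ContinuousMap.IsWeakHomotopyEquiv {A B : Type u} [TopologicalSpace A] [TopologicalSpace B]
    (f : C(A, B)) : Prop :=
  Function.Bijective f.onZerothHomotopy ∧
    ∀ (n : ℕ) (a : A), 1 ≤ n → Function.Bijective (f.onHomotopyGroup n a)

namespace PathFlow

/-! ### S-homotopy -/

/-- Weak S-homotopy equivalences. -/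
def IsWeakSHomotopyEquiv {X Y : PathFlow.{u}} (f : X ⟶ Y) : Prop :=
  Function.Bijective (Hom.state f) ∧ (Hom.onPaths f).IsWeakHomotopyEquiv

/-- `f` and `g` are S-homotopic: they are joined by a continuous family of morphisms of flows
(continuous on the discrete set of states means constant). -/
def SHomotopic {X Y : PathFlow.{u}} (f g : X ⟶ Y) : Prop :=
  ∃ H : unitInterval → (X ⟶ Y), H 0 = f ∧ H 1 = g ∧
    (∀ t a, Hom.state (H t) a = Hom.state f a) ∧
    Continuous (fun p : unitInterval × X.PathSpace => Hom.onPaths (H p.1) p.2)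

/-- S-homotopy equivalences. -/
def IsSHomotopyEquiv {X Y : PathFlow.{u}} (f : X ⟶ Y) : Prop :=
  ∃ g : Y ⟶ X, SHomotopic (f ≫ g) (𝟙 X) ∧ SHomotopic (g ≫ f) (𝟙 Y)

/-- `C` is a cofibrant replacement of `X` in `cell(Flow)`. -/
def IsCofibrantReplacement (C X : PathFlow.{u}) : Prop :=
  C.IsCell ∧ ∃ p : C ⟶ X, IsWeakSHomotopyEquiv p

/-! ### T-homotopy -/

/-- The restriction of the flow `X` to a set `A` of states. -/
def restrict (X : PathFlow.{u}) (A : Set X.State) : PathFlow.{u} where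
  State := A
  Path a b := X.Path a b
  comp := X.comp
  continuous_comp a b c := X.continuous_comp a b c
  assoc := X.assoc

/-- The morphism `f : X ⟶ Y`, seen as a morphism from `X` to the restriction of `Y` to `f(X⁰)`. -/
def Hom.toRestrict {X Y : PathFlow.{u}} (f : X ⟶ Y) : X ⟶ Y.restrict (Set.range (Hom.state f)) :=
  Hom.mk (X := X) (Y := Y.restrict (Set.range (Hom.state f))) (fun a => ⟨Hom.state f a, a, rfl⟩)
    (fun x => Hom.path f x) (fun a b => Hom.continuous_path f a b)
    (fun x y => Hom.map_comp f x y)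

/-- The smallest equivalence relation on the space of paths that start from `a` which identifies
`x` with `x * y` and whose quotient is weak Hausdorff. -/
def branchingSetoid (X : PathFlow.{u}) (a : X.State) : Setoid (Σ b, X.Path a b) :=
  sInf {r | (∀ (b c : X.State) (x : X.Path a b) (y : X.Path b c), r ⟨b, x⟩ ⟨c, X.comp x y⟩) ∧
    WeaklyHausdorffSpace (Quotient r)}

/-- The branching space at `a`: the quotient, in the category of compactly generated spaces,
of the space of paths that start from `a` by the identifications `x = x * y`. -/
abbrev BranchingSpace (X : PathFlow.{u}) (a : X.State) : Type u := Quotient (X.branchingSetoid a)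

/-- The smallest equivalence relation on the space of paths that end at `a` which identifies
`x` with `y * x` and whose quotient is weak Hausdorff. -/
def mergingSetoid (X : PathFlow.{u}) (a : X.State) : Setoid (Σ b, X.Path b a) :=
  sInf {r | (∀ (b c : X.State) (x : X.Path b a) (y : X.Path c b), r ⟨b, x⟩ ⟨c, X.comp y x⟩) ∧
    WeaklyHausdorffSpace (Quotient r)}

/-- The merging space at `a`: the quotient, in the category of compactly generated spaces,
of the space of paths that end at `a` by the identifications `x = y * x`. -/
abbrev MergingSpace (X : PathFlow.{u}) (a : X.State) : Type u := Quotient (X.mergingSetoid a)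

/-- `A` is surrounded by `B` in `X`. -/
def Surrounded (X : PathFlow.{u}) (A B : Set X.State) : Prop :=
  ∀ a ∈ A, a ∈ B ∨ ((∃ b ∈ B, Nonempty (X.Path b a)) ∧ ∃ c ∈ B, Nonempty (X.Path a c))

/-- T-homotopy equivalences (in the original sense). -/
structure IsTHomotopyEquiv {X Y : PathFlow.{u}} (f : X ⟶ Y) : Prop where
  isIso : IsIso (Hom.toRestrict f)
  branching : ∀ a ∉ Set.range (Hom.state f), Nonempty (Unique (Y.BranchingSpace a))
  merging : ∀ a ∉ Set.range (Hom.state f), Nonempty (Unique (Y.MergingSpace a))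
  surrounded : Y.Surrounded Set.univ (Set.range (Hom.state f))

end PathFlow

/-!
The states of a flow carry the transitive relation "there is an execution path from `a` to `b`",
which S-homotopy equivalences preserve. A flow of `cell(Flow)` lifts against trivial fibrations;
applied to the flow of its paths with a suitable label, this provides a continuous additive length
of its paths, and then a continuous choice, on every path `x`, of nonzero nonnegative weights on the
states that are substantially on the way along `x`, such that `x * y` has the weights of `x`. If the
branching space at `a` is a singleton, then all paths from `a` have the same weights, so that some
state lies on the way along all of them: it is the least state strictly above `a`. Reversing the
paths, a singleton merging space provides a greatest state strictly below `a`.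

Hence a T-homotopy equivalence only adds states which have both a least state above and a greatest
state below. For `n ≥ 3` no vertex of the Boolean lattice with `n` atoms has both, so that these
`2 ^ n` vertices persist, as a core of the states, along the whole zig-zag. But the directed segment
has only two states.
-/

/-! ### Least elements above a point -/

section LeastAbove

variable {α β ι : Type*} {R : α → α → Prop} {Q : β → β → Prop} {r : ι → ι → Prop}
  {A B : Set α} {a b : α}

/-- `b` is the least element of `B` strictly above `a`, where `R x y` is read as `x < y`. Greatest
elements strictly below `a` are obtained for `Function.swap R`. -/
def IsLeastAbove (R : α → α → Prop) (B : Set α) (a b : α) : Prop :=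
  b ∈ B ∧ R a b ∧ ∀ c ∈ B, R a c → b = c ∨ R b c

/-- Some element of `B` is the least one strictly above `a`. -/
def HasLeastAbove (R : α → α → Prop) (B : Set α) (a : α) : Prop :=
  ∃ b, IsLeastAbove R B a b

theorem HasLeastAbove.of_subset [IsTrans α R] (h : HasLeastAbove R A a) (hBA : B ⊆ A)
    (hB : ∀ x ∈ A, x ∉ B → HasLeastAbove R B x) : HasLeastAbove R B a := by
  obtain ⟨b, hbA, hab, hb⟩ := h
  by_cases hbB : b ∈ B
  · exact ⟨b, hbB, hab, fun c hc => hb c (hBA hc)⟩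
  obtain ⟨c, hcB, hbc, hc⟩ := hB b hbA hbB
  refine ⟨c, hcB, trans_of R hab hbc, fun d hd had => hc d hd ?_⟩
  obtain rfl | hbd := hb d (hBA hd) had
  exacts [absurd hd hbB, hbd]

theorem isLeastAbove_image_iff (f : R ↪r Q) :
    IsLeastAbove Q (f '' B) (f a) (f b) ↔ IsLeastAbove R B a b := by
  simp only [IsLeastAbove, Set.forall_mem_image, f.injective.mem_set_image, f.map_rel_iff,
    f.injective.eq_iff]

theorem hasLeastAbove_image_iff (f : R ↪r Q) :
    HasLeastAbove Q (f '' B) (f a) ↔ HasLeastAbove R B a := by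
  constructor
  · rintro ⟨_, h⟩
    obtain ⟨b, -, rfl⟩ := h.1
    exact ⟨b, (isLeastAbove_image_iff f).1 h⟩
  · rintro ⟨b, h⟩
    exact ⟨f b, (isLeastAbove_image_iff f).2 h⟩

/-- Above every point outside the image of `e` there is a least point of that image: for a partial
order, the image is a reflective subset. -/
def IsReflective (e : r ↪r R) : Prop :=
  ∀ x ∉ Set.range e, HasLeastAbove R (Set.range e) x

theorem IsReflective.of_surjective {e : r ↪r R} (h : Function.Surjective e) : IsReflective e :=
  fun x hx => absurd (h x) hx

theorem range_relEmbedding_trans (e : r ↪r R) (f : R ↪r Q) :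
    Set.range (e.trans f) = f '' Set.range e :=
  Set.range_comp f e

theorem IsReflective.trans [IsTrans β Q] {e : r ↪r R} {f : R ↪r Q} (he : IsReflective e)
    (hf : IsReflective f) : IsReflective (e.trans f) := by
  have on_range : ∀ a, f a ∉ f '' Set.range e → HasLeastAbove Q (f '' Set.range e) (f a) :=
    fun a ha => (hasLeastAbove_image_iff f).2 (he a fun h => ha ⟨a, h, rfl⟩)
  intro x hx
  rw [range_relEmbedding_trans] at hx ⊢
  by_cases hxf : x ∈ Set.range f
  · obtain ⟨a, rfl⟩ := hxf
    exact on_range a hx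
  · refine (hf x hxf).of_subset (Set.image_subset_range f _) ?_
    rintro _ ⟨a, rfl⟩
    exact on_range a

theorem IsReflective.of_trans {e : r ↪r R} {f : R ↪r Q} (h : IsReflective (e.trans f)) :
    IsReflective e := fun x hx => by
  rw [← hasLeastAbove_image_iff f, ← range_relEmbedding_trans]
  refine h _ ?_
  rwa [range_relEmbedding_trans, f.injective.mem_set_image]

/-- `r` is a core of `R`: it embeds into `R` in such a way that every point of `R` outside the image
has a least point of the image above it and a greatest one below it. -/
def HasCore (R : α → α → Prop) (r : ι → ι → Prop) : Prop :=
  ∃ e : r ↪r R, IsReflective e ∧ IsReflective e.swap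

theorem HasCore.refl (r : ι → ι → Prop) : HasCore r r :=
  ⟨.refl r, .of_surjective Function.surjective_id, .of_surjective Function.surjective_id⟩

theorem HasCore.map [IsTrans β Q] (h : HasCore R r) (f : R ↪r Q) (hf : IsReflective f)
    (hf' : IsReflective f.swap) : HasCore Q r :=
  have ⟨e, he, he'⟩ := h
  ⟨e.trans f, he.trans hf, he'.trans (f := f.swap) hf'⟩

theorem HasCore.congr [IsTrans β Q] (h : HasCore R r) (f : R ≃r Q) : HasCore Q r :=
  h.map f.toRelEmbedding (.of_surjective f.surjective) (.of_surjective f.surjective)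

theorem HasCore.card_le (h : HasCore R r) : ENat.card ι ≤ ENat.card α :=
  have ⟨e, _⟩ := h
  ENat.card_le_card_of_injective e.injective

/-- No point of `r` has both a least point above it and a greatest point below it. -/
def IsRigid (r : ι → ι → Prop) : Prop :=
  ∀ k, HasLeastAbove r Set.univ k → ¬ HasLeastAbove (Function.swap r) Set.univ k

theorem IsReflective.hasLeastAbove_univ [IsTrans α R] {e : r ↪r R} (he : IsReflective e) {k : ι}
    (h : HasLeastAbove R Set.univ (e k)) : HasLeastAbove r Set.univ k := by
  rw [← hasLeastAbove_image_iff e, Set.image_univ]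
  exact h.of_subset (Set.subset_univ _) fun x _ => he x

/-- A rigid core cannot meet the points that have both a least point above them and a greatest point
below them, so it survives their removal. -/
theorem HasCore.of_relEmbedding [IsTrans β Q] (h : HasCore Q r) (hr : IsRigid r) (f : R ↪r Q)
    (hf : ∀ y ∉ Set.range f, HasLeastAbove Q Set.univ y)
    (hf' : ∀ y ∉ Set.range f, HasLeastAbove (Function.swap Q) Set.univ y) : HasCore R r := by
  obtain ⟨e, he, he'⟩ := h
  have e_mem : ∀ k, e k ∈ Set.range f := fun k => by
    by_contra hk
    exact hr k (he.hasLeastAbove_univ (hf _ hk)) (he'.hasLeastAbove_univ (hf' _ hk))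
  choose g hg using e_mem
  have g_rel : ∀ {i j}, R (g i) (g j) ↔ r i j := fun {i j} => by
    rw [← f.map_rel_iff, hg, hg, e.map_rel_iff]
  have g_inj : Function.Injective g := fun i j hij => e.injective (by rw [← hg, ← hg, hij])
  let e₀ : r ↪r R := ⟨⟨g, g_inj⟩, g_rel⟩
  obtain rfl : e = e₀.trans f := RelEmbedding.ext fun k => (hg k).symm
  exact ⟨e₀, he.of_trans, he'.of_trans (e := e₀.swap) (f := f.swap)⟩

end LeastAbove

/-! ### Boolean algebras -/

section BooleanAlgebra

variable {α : Type*} [BooleanAlgebra α] {a : α}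

theorem isCoatom_of_hasLeastAbove_lt (h : HasLeastAbove (· < ·) Set.univ a) : IsCoatom a := by
  obtain ⟨s, -, has, hs⟩ := h
  have s_le : ∀ c, a < c → s ≤ c := fun c hc => (hs c trivial hc).elim Eq.le le_of_lt
  have sup_compl : a ⊔ sᶜ = a := by
    by_contra hne
    have s_le_sup : s ≤ a ⊔ sᶜ := s_le _ (le_sup_left.lt_of_ne' hne)
    rw [← himp_eq, le_himp_iff, inf_idem] at s_le_sup
    exact has.not_ge s_le_sup
  have s_eq_top : s = ⊤ := compl_le_self.1 ((sup_eq_left.1 sup_compl).trans has.le)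
  exact ⟨has.ne_top, fun c hc => top_le_iff.1 (s_eq_top ▸ s_le c hc)⟩

theorem isAtom_of_hasLeastAbove_gt (h : HasLeastAbove (Function.swap (· < ·)) Set.univ a) :
    IsAtom a :=
  isCoatom_dual_iff_isAtom.1 (isCoatom_of_hasLeastAbove_lt (α := αᵒᵈ) h)

theorem eq_or_eq_of_isAtom_of_isCoatom (hatom : IsAtom a) (hcoatom : IsCoatom a) (b : α) :
    b = ⊥ ∨ b = a ∨ b = aᶜ ∨ b = ⊤ := by
  rcases hatom.le_iff.1 (inf_le_right : b ⊓ a ≤ a) with hinf | hinf <;>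
    rcases hcoatom.le_iff.1 (le_sup_right : a ≤ b ⊔ a) with hsup | hsup
  · exact .inr (.inr (.inl (IsCompl.of_eq hinf hsup).eq_compl))
  · exact .inl (by rwa [inf_eq_left.2 (sup_eq_right.1 hsup)] at hinf)
  · exact .inr (.inr (.inr (by rwa [sup_eq_left.2 (inf_eq_right.1 hinf)] at hsup)))
  · exact .inr (.inl ((sup_eq_right.1 hsup).antisymm (inf_eq_right.1 hinf)))

theorem isRigid_lt (h : 4 < ENat.card α) : IsRigid ((· < ·) : α → α → Prop) := by
  intro a habove hbelow
  classical
  have univ_subset : (Set.univ : Set α) ⊆ ({⊥, a, aᶜ, ⊤} : Finset α) := fun b _ => by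
    simpa using eq_or_eq_of_isAtom_of_isCoatom (isAtom_of_hasLeastAbove_gt hbelow)
      (isCoatom_of_hasLeastAbove_lt habove) b
  have card_le := Set.encard_le_encard univ_subset
  rw [Set.encard_univ, Set.encard_coe_eq_coe_finsetCard] at card_le
  exact h.not_ge (card_le.trans (mod_cast Finset.card_le_four))

end BooleanAlgebra

/-! ### Topology -/

section Topology

open Topology

theorem WeaklyHausdorffSpace.of_injective_continuous {X Y : Type u} [TopologicalSpace X]
    [TopologicalSpace Y] [WeaklyHausdorffSpace Y] {f : X → Y} (hf : Continuous f)
    (hinj : Function.Injective f) : WeaklyHausdorffSpace X := by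
  refine ⟨fun K _ _ _ g hg => ?_⟩
  have := (WeaklyHausdorffSpace.isClosed_range K (f ∘ g) (hf.comp hg)).preimage hf
  rwa [Set.range_comp, hinj.preimage_image] at this

theorem fst_eq_of_joined {ι : Type*} {X : ι → Type*} [∀ i, TopologicalSpace (X i)]
    {x y : Σ i, X i} (h : Joined x y) : x.1 = y.1 := by
  let _ : TopologicalSpace ι := ⊥
  have : DiscreteTopology ι := ⟨rfl⟩
  have hfst : Continuous (Sigma.fst : (Σ i, X i) → ι) := continuous_sigma fun _ => continuous_const
  obtain ⟨γ⟩ := h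
  simpa using PreconnectedSpace.constant inferInstance (hfst.comp γ.continuous) (x := 0) (y := 1)

variable {A X : Type*} [TopologicalSpace A] [TopologicalSpace X]

/-- Tietze's extension theorem on the closed set `Set.range i ∪ Uᶜ`. -/
theorem exists_nonneg_extension_support_subset [NormalSpace X] {i : A → X}
    (hi : IsClosedEmbedding i) {U : Set X} (hU : IsOpen U) {f : A → ℝ} (hf : Continuous f)
    (hf₀ : 0 ≤ f) (hfU : f.support ⊆ i ⁻¹' U) :
    ∃ g : C(X, ℝ), 0 ≤ g ∧ Function.support g ⊆ U ∧ ∀ a, g (i a) = f a := by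
  let e : X → ℝ := Function.extend i f 0
  have e_apply : ∀ a, e (i a) = f a := hi.injective.extend_apply f 0
  have e_apply' : ∀ x ∉ Set.range i, e x = 0 := fun x hx =>
    Function.extend_apply' f (0 : X → ℝ) x hx
  have e_eq_zero : ∀ x ∉ U, e x = 0 := fun x hx => by
    by_contra hne
    obtain ⟨a, rfl⟩ := not_imp_comm.1 (e_apply' x) hne
    exact hx (hfU ((e_apply a).symm.trans_ne hne))
  have e_nonneg : ∀ x, 0 ≤ e x := fun x => by
    by_cases hx : x ∈ Set.range i
    · obtain ⟨a, rfl⟩ := hx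
      exact (hf₀ a).trans_eq (e_apply a).symm
    · exact (e_apply' x hx).ge
  have e_cont : ContinuousOn e (Set.range i ∪ Uᶜ) := by
    refine ContinuousOn.union_of_isClosed ?_ ?_ hi.isClosed_range hU.isClosed_compl
    · rw [continuousOn_iff_continuous_domRestrict,
        ← hi.isEmbedding.toHomeomorph.comp_continuous_iff']
      exact hf.congr fun a => (e_apply a).symm
    · exact continuousOn_const.congr e_eq_zero
  obtain ⟨g, hg₀, hg⟩ := ContinuousMap.exists_restrict_eq_forall_mem_of_closed
    ⟨_, continuousOn_iff_continuous_domRestrict.1 e_cont⟩ (t := Set.Ici 0) (fun x => e_nonneg x)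
    Set.nonempty_Ici (hi.isClosed_range.union hU.isClosed_compl)
  have g_eq : ∀ x ∈ Set.range i ∪ Uᶜ, g x = e x := fun x hx => DFunLike.congr_fun hg ⟨x, hx⟩
  refine ⟨g, hg₀, fun x hx => ?_, fun a => (g_eq _ (.inl ⟨a, rfl⟩)).trans (e_apply a)⟩
  by_contra hxU
  exact hx ((g_eq x (.inr hxU)).trans (e_eq_zero x hxU))

theorem isClosedEmbedding_diskBoundaryInclusion (n : ℕ) :
    IsClosedEmbedding (TopCat.diskBoundaryInclusion.{u} n).hom :=
  (TopCat.diskBoundaryInclusion.{u} n).hom.continuous.isClosedEmbedding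
    ((TopCat.mono_iff_injective _).1 inferInstance)

theorem exists_nonneg_eq_zero_iff_mem_range_diskBoundaryInclusion (n : ℕ) :
    ∃ ρ : C(TopCat.disk.{u} n, ℝ), 0 ≤ ρ ∧
      ∀ x, ρ x = 0 ↔ x ∈ Set.range (TopCat.diskBoundaryInclusion.{u} n).hom := by
  refine ⟨⟨fun x => 1 - ‖x.down.1‖, by fun_prop⟩, fun x => ?_, fun x => ?_⟩
  · exact sub_nonneg.2 (mem_closedBall_zero_iff.1 x.down.2)
  constructor
  · intro h
    exact ⟨⟨x.down.1, mem_sphere_zero_iff_norm.2 (sub_eq_zero.1 h).symm⟩, rfl⟩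
  · rintro ⟨s, rfl⟩
    exact sub_eq_zero.2 (mem_sphere_zero_iff_norm.1 s.down.2).symm

end Topology

namespace PathFlow

/-! ### Cofibrant flows -/

section Cofibrant

variable {X Y : PathFlow.{u}}

/-- The flow `X` with all its execution paths reversed. -/
def op (X : PathFlow.{u}) : PathFlow.{u} where
  State := X.State
  Path a b := X.Path b a
  comp x y := X.comp y x
  continuous_comp a b c := ((X.kContinuous_comp c b a).flip).continuous
  assoc x y z := (X.assoc z y x).symm

/-- The morphism `f` between the reversed flows. -/
def Hom.op (f : X ⟶ Y) : X.op ⟶ Y.op :=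
  Hom.mk (X := X.op) (Y := Y.op) (Hom.state (X := X) (Y := Y) f)
    (fun x => Hom.path (X := X) (Y := Y) f x)
    (fun a b => Hom.continuous_path (X := X) (Y := Y) f b a)
    (fun x y => Hom.map_comp (X := X) (Y := Y) f y x)

theorem Hom.mk_eq_mk_iff {v : X.State → Y.State}
    {p q : ∀ {a b}, X.Path a b → Y.Path (v a) (v b)} {hp hq hp' hq'} :
    (Hom.mk v p hp hp' : Hom X Y) = Hom.mk v q hq hq' ↔ ∀ a b (x : X.Path a b), p x = q x := by
  rw [Hom.mk.injEq, heq_eq_eq, and_iff_right rfl]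
  exact ⟨fun h a b x => congrArg (fun φ : ∀ {a b}, _ → _ => @φ a b x) h,
    fun h => by funext a b x; exact h a b x⟩

/-- Trivial fibrations: bijections on states which have the right lifting property with respect to
the inclusions of spheres into disks on each space of paths. -/
structure IsTrivialFibration (p : X ⟶ Y) : Prop where
  bijective : Function.Bijective (Hom.state p)
  lift : ∀ (a b : X.State) (n : ℕ) (i : C(TopCat.diskBoundary.{u} n, X.Path a b))
    (j : C(TopCat.disk.{u} n, Y.Path (Hom.state p a) (Hom.state p b))),
    (∀ s, Hom.path p (i s) = j ((TopCat.diskBoundaryInclusion.{u} n).hom s)) →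
    ∃ l : C(TopCat.disk.{u} n, X.Path a b),
      (∀ s, l ((TopCat.diskBoundaryInclusion.{u} n).hom s) = i s) ∧ ∀ x, Hom.path p (l x) = j x

theorem IsTrivialFibration.op {p : X ⟶ Y} (hp : IsTrivialFibration p) :
    IsTrivialFibration (Hom.op p) :=
  ⟨hp.bijective, fun a b => hp.lift b a⟩

/-- Cofibrant flows: every morphism to the base of a trivial fibration lifts. -/
def IsCofibrant (Y : PathFlow.{u}) : Prop :=
  ∀ ⦃E D : PathFlow.{u}⦄ (p : E ⟶ D), IsTrivialFibration p → ∀ g : Y ⟶ D, ∃ l : Y ⟶ E, l ≫ p = g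

theorem IsCofibrant.op (hY : Y.IsCofibrant) : Y.op.IsCofibrant := by
  intro E D p hp g
  obtain ⟨l, hl⟩ := hY (Hom.op p) hp.op (Hom.op g)
  exact ⟨Hom.op l, congrArg (fun k => Hom.op k) hl⟩

/-- The morphism from a flow without paths given by a map on states. -/
def discreteDesc {S : Type u} (v : S → X.State) : discrete S ⟶ X :=
  Hom.mk (X := discrete S) (Y := X) v (fun x => x.elim)
    (fun _ _ => continuous_of_isEmpty (fun k => k.elim) _) (fun x _ => x.elim)

theorem discrete_hom_ext {S : Type u} {f g : discrete S ⟶ X} (h : Hom.state f = Hom.state g) :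
    f = g := by
  obtain ⟨v, p, _, _⟩ := f
  obtain ⟨w, q, _, _⟩ := g
  obtain rfl : v = w := h
  exact Hom.mk_eq_mk_iff.2 fun _ _ x => x.elim

/-- The morphism from a globe given by a map to a space of paths. -/
def globDesc {Z : Type u} [TopologicalSpace Z] [CompactlyGeneratedSpace Z]
    [WeaklyHausdorffSpace Z] (v : GlobState.{u} → X.State)
    (φ : C(Z, X.Path (v .bot) (v .top))) : glob Z ⟶ X :=
  Hom.mk (X := glob Z) (Y := X) v
    (fun {a b} => match a, b with
      | .bot, .top => φ
      | .bot, .bot => fun x => PEmpty.elim x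
      | .top, _ => fun x => PEmpty.elim x)
    (fun a b => match a, b with
      | .bot, .top => φ.continuous
      | .bot, .bot => continuous_of_isEmpty (fun k => PEmpty.elim k) _
      | .top, _ => continuous_of_isEmpty (fun k => PEmpty.elim k) _)
    (fun x y => (GlobPath.not_composable x y).elim)

theorem glob_hom_ext {Z : Type u} [TopologicalSpace Z] [CompactlyGeneratedSpace Z]
    [WeaklyHausdorffSpace Z] {v : GlobState.{u} → X.State}
    {p q : ∀ {a b}, (glob Z).Path a b → X.Path (v a) (v b)} {hp hq hp' hq'}
    (h : ∀ z : Z, p (a := .bot) (b := .top) z = q (a := .bot) (b := .top) z) :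
    (Hom.mk (X := glob Z) v p hp hp' : glob Z ⟶ X) = Hom.mk (X := glob Z) v q hq hq' :=
  Hom.mk_eq_mk_iff.2 fun
    | .bot, .top => h
    | .bot, .bot => fun x => PEmpty.elim x
    | .top, _ => fun x => PEmpty.elim x

theorem IsTrivialFibration.hasLiftingProperty_globMap {p : X ⟶ Y} (hp : IsTrivialFibration p)
    (n : ℕ) : HasLiftingProperty (globMap (TopCat.diskBoundaryInclusion.{u} n).hom) p where
  sq_hasLift {f g} sq := by
    obtain ⟨w, q, hq, _⟩ := g
    obtain ⟨v, i, hi, _⟩ := f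
    obtain rfl : Hom.state p ∘ v = w := congrArg (fun k => Hom.state k) sq.w
    obtain ⟨l, l_boundary, path_l⟩ := hp.lift (v .bot) (v .top) n
      ⟨i (a := .bot) (b := .top), hi _ _⟩
      ⟨q (a := .bot) (b := .top), hq _ _⟩ (Hom.mk_eq_mk_iff.1 sq.w .bot .top)
    exact ⟨⟨globDesc v l, glob_hom_ext l_boundary, glob_hom_ext path_l⟩⟩

theorem IsTrivialFibration.hasLiftingProperty_discreteMap {p : X ⟶ Y} (hp : IsTrivialFibration p)
    {S T : Type u} (φ : S → T) : HasLiftingProperty (discreteMap φ) p where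
  sq_hasLift {f g} sq := by
    choose v hv using fun t => hp.bijective.2 (Hom.state g t)
    refine ⟨⟨discreteDesc v, discrete_hom_ext ?_, discrete_hom_ext (funext hv)⟩⟩
    have square : ∀ s, Hom.state p (Hom.state f s) = Hom.state g (φ s) :=
      congrFun (congrArg (fun k => Hom.state k) sq.w)
    exact funext fun s => hp.bijective.1 ((hv (φ s)).trans (square s).symm)

theorem IsTrivialFibration.rlp {p : X ⟶ Y} (hp : IsTrivialFibration p) :
    GeneratingCofibration.rlp p
  | _, _, _, .globe n => hp.hasLiftingProperty_globMap n
  | _, _, _, .collapse => hp.hasLiftingProperty_discreteMap _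
  | _, _, _, .point => hp.hasLiftingProperty_discreteMap _

theorem IsCell.isCofibrant (hY : Y.IsCell) : Y.IsCofibrant := by
  intro E D p hp g
  have hrlp : GeneratingCofibration.{u}.pushouts.rlp p := by
    rw [MorphismProperty.rlp_pushouts]
    exact hp.rlp
  have := MorphismProperty.transfiniteCompositions_le_llp_rlp.{u} _ _ hY p hrlp
  have sq : CommSq (fromEmpty E) (fromEmpty Y) p g :=
    ⟨discrete_hom_ext (S := PEmpty) (funext fun x => PEmpty.elim x)⟩
  exact ⟨sq.lift, sq.fac_right⟩

end Cofibrant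

/-! ### Labellings of the paths -/

section Labelling

open TopCat (disk diskBoundary diskBoundaryInclusion)

variable {Y : PathFlow.{u}} {T : Type u} [TopologicalSpace T]

/-- A continuous associative composition law on a space `T` of labels, with the set of labels that
each path of `Y` is allowed to carry. -/
structure LabelLaw (Y : PathFlow.{u}) (T : Type u) [TopologicalSpace T] where
  label : ∀ {a b}, Y.Path a b → Set T
  mul : T → T → T
  continuous_mul : Continuous fun p : T × T => mul p.1 p.2
  mul_assoc : ∀ r s t, mul (mul r s) t = mul r (mul s t)
  mul_mem : ∀ {a b c} {x : Y.Path a b} {y : Y.Path b c} {s t},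
    s ∈ label x → t ∈ label y → mul s t ∈ label (Y.comp x y)

namespace LabelLaw

variable (L : Y.LabelLaw T)

/-- Along every disk of paths, the labels given on the boundary sphere extend to the disk. -/
def IsExtensible : Prop :=
  ∀ ⦃a b : Y.State⦄ (n : ℕ) (j : C(disk.{u} n, Y.Path a b)) (f : C(diskBoundary.{u} n, T)),
    (∀ s, f s ∈ L.label (j ((diskBoundaryInclusion n).hom s))) →
    ∃ g : C(disk.{u} n, T), (∀ x, g x ∈ L.label (j x)) ∧
      ∀ s, g ((diskBoundaryInclusion n).hom s) = f s

/-- A continuous and multiplicative choice of an allowed label on every path. -/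
structure Labelling where
  toFun : ∀ {a b}, Y.Path a b → T
  continuous_toFun : ∀ a b, Continuous (toFun : Y.Path a b → T)
  mem_label : ∀ {a b} (x : Y.Path a b), toFun x ∈ L.label x
  map_comp : ∀ {a b c} (x : Y.Path a b) (y : Y.Path b c),
    toFun (Y.comp x y) = L.mul (toFun x) (toFun y)

/-- The paths from `a` to `b` with an allowed label. The product with a point has the effect of
`k`-ifying the topology. -/
abbrev LabelledPath (a b : Y.State) : Type u :=
  KProd PUnit.{u + 1} {p : Y.Path a b × T // p.2 ∈ L.label p.1}

variable {L} in
theorem continuous_labelledPath_mk {K : Type u} [TopologicalSpace K] [CompactlyGeneratedSpace K]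
    {a b : Y.State} {x : K → Y.Path a b} {t : K → T} (hx : Continuous x) (ht : Continuous t)
    (h : ∀ k, t k ∈ L.label (x k)) :
    Continuous fun k => (⟨PUnit.unit, ⟨(x k, t k), h k⟩⟩ : L.LabelledPath a b) :=
  KProd.continuous_mk continuous_const ((hx.prodMk ht).subtype_mk h)

theorem continuous_path_labelledPath (a b : Y.State) :
    Continuous fun x : L.LabelledPath a b => x.snd.1.1 :=
  continuous_fst.comp (continuous_subtype_val.comp KProd.continuous_snd)

theorem continuous_label_labelledPath (a b : Y.State) :
    Continuous fun x : L.LabelledPath a b => x.snd.1.2 :=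
  continuous_snd.comp (continuous_subtype_val.comp KProd.continuous_snd)

instance [T2Space T] (a b : Y.State) : WeaklyHausdorffSpace (L.LabelledPath a b) :=
  have : WeaklyHausdorffSpace T := .of_t2
  .of_injective_continuous (f := fun x => (⟨x.snd.1.1, x.snd.1.2⟩ : KProd (Y.Path a b) T))
    (KProd.continuous_mk (L.continuous_path_labelledPath a b) (L.continuous_label_labelledPath a b))
    fun _ _ h =>
      KProd.ext rfl (Subtype.ext (Prod.ext (congrArg KProd.fst h) (congrArg KProd.snd h)))

/-- The flow of the labelled paths of `Y`. -/
def labelled [T2Space T] : PathFlow.{u} where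
  State := Y.State
  Path := L.LabelledPath
  comp x y := ⟨PUnit.unit, ⟨(Y.comp x.snd.1.1 y.snd.1.1, L.mul x.snd.1.2 y.snd.1.2),
    L.mul_mem x.snd.2 y.snd.2⟩⟩
  continuous_comp a b c := KProd.continuous_of_compact fun K _ _ _ _ _ hf hg =>
    continuous_labelledPath_mk
      (Y.kContinuous_comp a b c K _ _ ((L.continuous_path_labelledPath a b).comp hf)
        ((L.continuous_path_labelledPath b c).comp hg))
      (L.continuous_mul.comp (((L.continuous_label_labelledPath a b).comp hf).prodMk
        ((L.continuous_label_labelledPath b c).comp hg))) _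
  assoc _ _ _ := KProd.ext rfl (Subtype.ext (Prod.ext (Y.assoc _ _ _) (L.mul_assoc _ _ _)))

/-- The morphism that forgets the labels. -/
def forget [T2Space T] : L.labelled ⟶ Y :=
  Hom.mk (X := L.labelled) (Y := Y) id (fun x => x.snd.1.1) L.continuous_path_labelledPath
    (fun _ _ => rfl)

variable {L}

theorem IsExtensible.exists_lift (hL : L.IsExtensible) (a b : Y.State) (n : ℕ)
    (i : C(diskBoundary.{u} n, L.LabelledPath a b)) (j : C(disk.{u} n, Y.Path a b))
    (hij : ∀ s, (i s).snd.1.1 = j ((diskBoundaryInclusion n).hom s)) :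
    ∃ l : C(disk.{u} n, L.LabelledPath a b),
      (∀ s, l ((diskBoundaryInclusion n).hom s) = i s) ∧ ∀ x, (l x).snd.1.1 = j x := by
  have i_mem : ∀ s, (i s).snd.1.2 ∈ L.label (j ((diskBoundaryInclusion n).hom s)) :=
    fun s => hij s ▸ (i s).snd.2
  obtain ⟨g, hg, g_boundary⟩ := hL n j
    ⟨_, (L.continuous_label_labelledPath a b).comp i.continuous⟩ i_mem
  refine ⟨⟨_, continuous_labelledPath_mk j.continuous g.continuous hg⟩, fun s => ?_, fun x => rfl⟩
  exact KProd.ext rfl (Subtype.ext (Prod.ext (hij s).symm (g_boundary s)))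

theorem IsExtensible.isTrivialFibration_forget [T2Space T] (hL : L.IsExtensible) :
    IsTrivialFibration L.forget :=
  ⟨Function.bijective_id, hL.exists_lift⟩

theorem IsExtensible.nonempty_labelling [T2Space T] (hL : L.IsExtensible) (hY : Y.IsCofibrant) :
    Nonempty L.Labelling := by
  obtain ⟨⟨v, p, p_cont, p_comp⟩, hl⟩ := hY L.forget hL.isTrivialFibration_forget (𝟙 Y)
  obtain rfl : v = id := congrArg (fun k => Hom.state k) hl
  have path_p : ∀ a b (x : Y.Path a b), (p x).snd.1.1 = x := Hom.mk_eq_mk_iff.1 hl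
  exact ⟨{
    toFun := fun x => (p x).snd.1.2
    continuous_toFun := fun a b => (L.continuous_label_labelledPath a b).comp (p_cont a b)
    mem_label := fun x => by simpa only [path_p] using (p x).snd.2
    map_comp := fun x y =>
      congrArg (fun z : L.LabelledPath _ _ => z.snd.1.2) (p_comp x y) }⟩

end LabelLaw

end Labelling

/-! ### Lengths and weights -/

section Length

open TopCat (disk diskBoundary diskBoundaryInclusion)

variable {Y : PathFlow.{u}}

/-- There is an execution path from `a` to `b`. -/
def Reaches (X : PathFlow.{u}) (a b : X.State) : Prop := Nonempty (X.Path a b)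

instance (X : PathFlow.{u}) : IsTrans X.State X.Reaches where
  trans _ _ _ := fun ⟨x⟩ ⟨y⟩ => ⟨X.comp x y⟩

/-- A continuous additive length on the paths of `Y`. The lower bound `2` leaves room for the
comparison of lengths up to `1` in `Length.waypoints`. -/
structure Length (Y : PathFlow.{u}) where
  toFun : ∀ {a b}, Y.Path a b → ℝ
  continuous_toFun : ∀ a b, Continuous (toFun : Y.Path a b → ℝ)
  two_le : ∀ {a b} (x : Y.Path a b), 2 ≤ toFun x
  map_comp : ∀ {a b c} (x : Y.Path a b) (y : Y.Path b c), toFun (Y.comp x y) = toFun x + toFun y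

instance : CoeFun Y.Length fun _ => ∀ {a b}, Y.Path a b → ℝ := ⟨Length.toFun⟩

/-- The label law of lengths: addition of real numbers that are at least `2`. -/
def lengthLaw (Y : PathFlow.{u}) : Y.LabelLaw (ULift.{u} ℝ) where
  label _ := {t | 2 ≤ t.down}
  mul s t := ⟨s.down + t.down⟩
  continuous_mul := by fun_prop
  mul_assoc _ _ _ := congrArg ULift.up (add_assoc _ _ _)
  mul_mem {_ _ _ _ _ s t} (hs : 2 ≤ s.down) (ht : 2 ≤ t.down) :=
    show 2 ≤ s.down + t.down by linarith

theorem isExtensible_lengthLaw (Y : PathFlow.{u}) : Y.lengthLaw.IsExtensible := by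
  intro a b n j f hf
  obtain ⟨g, hg, g_boundary⟩ := ContinuousMap.exists_extension_forall_mem_of_isClosedEmbedding
    ⟨fun s => (f s).down, by fun_prop⟩ (t := Set.Ici 2) hf Set.nonempty_Ici
    (isClosedEmbedding_diskBoundaryInclusion.{u} n)
  exact ⟨⟨fun x => ⟨g x⟩, by fun_prop⟩, hg,
    fun s => ULift.ext _ _ (congrFun g_boundary s)⟩

theorem IsCofibrant.nonempty_length (hY : Y.IsCofibrant) : Nonempty Y.Length := by
  obtain ⟨φ⟩ := Y.isExtensible_lengthLaw.nonempty_labelling hY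
  exact ⟨⟨fun x => (φ.toFun x).down, fun a b => continuous_uliftDown.comp (φ.continuous_toFun a b),
    φ.mem_label, fun x y => congrArg ULift.down (φ.map_comp x y)⟩⟩

namespace Length

variable (ℓ : Y.Length) {a b c : Y.State}

/-- The states which are substantially on the way along `x`: its end point, and the states reached
from its starting point from which some path leads to the end point and is shorter than `x` by more
than `1`. -/
def waypoints (x : Y.Path a b) : Set Y.State :=
  {c | c = b ∨ Y.Reaches a c ∧ ∃ z : Y.Path c b, ℓ z + 1 < ℓ x}

theorem isOpen_setOf_mem_waypoints (a b c : Y.State) :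
    IsOpen {x : Y.Path a b | c ∈ ℓ.waypoints x} := by
  have h : IsOpen {x : Y.Path a b | ∃ z : Y.Path c b, ℓ z + 1 < ℓ x} := by
    simp only [Set.ofPred_exists]
    exact isOpen_iUnion fun z => isOpen_lt continuous_const (ℓ.continuous_toFun a b)
  exact isOpen_const.union (isOpen_const.inter h)

theorem waypoints_subset_waypoints_comp (x : Y.Path a b) (y : Y.Path b c) :
    ℓ.waypoints x ⊆ ℓ.waypoints (Y.comp x y) := by
  simp only [waypoints, ℓ.map_comp]
  rintro d (rfl | ⟨had, z, hz⟩)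
  · exact .inr ⟨⟨x⟩, y, by linarith [ℓ.two_le x]⟩
  · exact .inr ⟨had, Y.comp z y, by rw [ℓ.map_comp]; linarith⟩

/-- The label law of weights: nonzero families of nonnegative weights on the way points of a path,
where a composite keeps the weights of its first factor. -/
def weightLaw : Y.LabelLaw (Y.State → ℝ) where
  label x := {w | 0 ≤ w ∧ w.support ⊆ ℓ.waypoints x ∧ w ≠ 0}
  mul w _ := w
  continuous_mul := continuous_fst
  mul_assoc _ _ _ := rfl
  mul_mem hw _ := ⟨hw.1, hw.2.1.trans (ℓ.waypoints_subset_waypoints_comp _ _), hw.2.2⟩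

/-- The weights given on the boundary sphere are extended one state at a time; a bump function on
the interior of the disk is added at the end point to keep the extension nonzero. -/
theorem isExtensible_weightLaw : ℓ.weightLaw.IsExtensible := by
  classical
  intro a b n j f hf
  have extension : ∀ c, ∃ g : C(disk.{u} n, ℝ), 0 ≤ g ∧
      Function.support g ⊆ {x | c ∈ ℓ.waypoints (j x)} ∧
      ∀ s, g ((diskBoundaryInclusion n).hom s) = f s c := fun c =>
    exists_nonneg_extension_support_subset (isClosedEmbedding_diskBoundaryInclusion n)
      ((ℓ.isOpen_setOf_mem_waypoints a b c).preimage j.continuous)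
      ((continuous_apply c).comp f.continuous) (fun s => (hf s).1 c) fun s hs => (hf s).2.1 hs
  choose g g_nonneg g_support g_boundary using extension
  obtain ⟨ρ, ρ_nonneg, ρ_eq_zero⟩ :=
    exists_nonneg_eq_zero_iff_mem_range_diskBoundaryInclusion.{u} n
  let w : C(disk.{u} n, Y.State → ℝ) := ⟨fun x => (fun c => g c x) + Pi.single b (ρ x),
    (continuous_pi fun c => (g c).continuous).add ((continuous_single b).comp ρ.continuous)⟩
  have w_boundary : ∀ s, w ((diskBoundaryInclusion n).hom s) = f s := fun s => by
    have hρ : ρ ((diskBoundaryInclusion n).hom s) = 0 := (ρ_eq_zero _).2 ⟨s, rfl⟩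
    simp only [w, ContinuousMap.coe_mk, hρ, Pi.single_zero, add_zero, g_boundary]
  have w_nonneg : ∀ x, 0 ≤ w x := fun x =>
    add_nonneg (fun c => g_nonneg c x) (Pi.single_nonneg.2 (ρ_nonneg x))
  have w_support : ∀ x, Function.support (w x) ⊆ ℓ.waypoints (j x) := fun x c hc => by
    by_cases hcb : c = b
    · exact .inl hcb
    · exact g_support c (by simpa [w, hcb] using hc)
  refine ⟨w, fun x => ⟨w_nonneg x, w_support x, fun hx => ?_⟩, w_boundary⟩
  by_cases hb : x ∈ Set.range (diskBoundaryInclusion n).hom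
  · obtain ⟨s, rfl⟩ := hb
    exact (hf s).2.2 ((w_boundary s).symm.trans hx)
  · have h_sum : g b x + ρ x = 0 := by simpa [w] using congrFun hx b
    exact hb ((ρ_eq_zero x).1 ((add_eq_zero_iff_of_nonneg (g_nonneg b x) (ρ_nonneg x)).1 h_sum).2)

end Length

end Length

/-! ### States with a singleton branching space -/

section Branching

variable {Y : PathFlow.{u}} {a : Y.State}

theorem branchingSetoid_le_ker {T : Type u} [TopologicalSpace T] [T2Space T]
    {φ : (Σ b, Y.Path a b) → T} (hφ : Continuous φ)
    (h : ∀ (b c : Y.State) (x : Y.Path a b) (y : Y.Path b c), φ ⟨b, x⟩ = φ ⟨c, Y.comp x y⟩) :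
    Y.branchingSetoid a ≤ Setoid.ker φ :=
  have : WeaklyHausdorffSpace T := .of_t2
  sInf_le ⟨h, .of_injective_continuous (hφ.quotient_lift fun _ _ => id)
    (Setoid.kerLift_injective φ)⟩

theorem IsCofibrant.exists_forall_mem_waypoints (hY : Y.IsCofibrant) (ℓ : Y.Length)
    (ha : Nonempty (Unique (Y.BranchingSpace a))) :
    ∃ b, Y.Reaches a b ∧ ∀ c (x : Y.Path a c), b ∈ ℓ.waypoints x := by
  obtain ⟨w⟩ := ℓ.isExtensible_weightLaw.nonempty_labelling hY
  obtain ⟨_⟩ := ha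
  have w_eq : ∀ p q : Σ b, Y.Path a b, w.toFun p.2 = w.toFun q.2 := fun p q =>
    branchingSetoid_le_ker (φ := fun p : Σ b, Y.Path a b => w.toFun p.2)
      (continuous_sigma (w.continuous_toFun a)) (fun _ _ x y => (w.map_comp x y).symm)
      (Quotient.exact (Subsingleton.elim (Quotient.mk _ p) (Quotient.mk _ q)))
  obtain ⟨⟨c, x⟩, -⟩ := Quotient.exists_rep (default : Y.BranchingSpace a)
  obtain ⟨b, hb⟩ := Function.ne_iff.1 (w.mem_label x).2.2
  have hb_mem : ∀ d (y : Y.Path a d), b ∈ ℓ.waypoints y := fun d y =>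
    (w.mem_label y).2.1 (w_eq ⟨c, x⟩ ⟨d, y⟩ ▸ hb)
  refine ⟨b, ?_, hb_mem⟩
  obtain rfl | ⟨hab, -⟩ := hb_mem c x
  exacts [⟨x⟩, hab]

theorem Length.isLeastAbove_of_forall_mem_waypoints (ℓ : Y.Length) {b : Y.State} {B : Set Y.State}
    (hbB : b ∈ B) (hab : Y.Reaches a b) (hb : ∀ c (x : Y.Path a c), b ∈ ℓ.waypoints x) :
    IsLeastAbove Y.Reaches B a b :=
  ⟨hbB, hab, fun c _ ⟨x⟩ => (hb c x).imp_right fun ⟨_, z, _⟩ => ⟨z⟩⟩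

theorem IsCofibrant.hasLeastAbove_univ (hY : Y.IsCofibrant)
    (ha : Nonempty (Unique (Y.BranchingSpace a))) : HasLeastAbove Y.Reaches Set.univ a := by
  obtain ⟨ℓ⟩ := hY.nonempty_length
  obtain ⟨b, hab, hb⟩ := hY.exists_forall_mem_waypoints ℓ ha
  exact ⟨b, ℓ.isLeastAbove_of_forall_mem_waypoints trivial hab hb⟩

theorem IsCofibrant.hasLeastAbove (hY : Y.IsCofibrant) {B : Set Y.State}
    (hB : ∀ a ∉ B, Nonempty (Unique (Y.BranchingSpace a)) ∧ ∃ b ∈ B, Y.Reaches a b) (ha : a ∉ B) :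
    HasLeastAbove Y.Reaches B a := by
  obtain ⟨ℓ⟩ := hY.nonempty_length
  have of_length_lt : ∀ (k : ℕ) (a c : Y.State) (x : Y.Path a c), a ∉ B → c ∈ B → ℓ x < k →
      HasLeastAbove Y.Reaches B a := by
    intro k
    induction k with
    | zero =>
      intro a c x _ _ hx
      linarith [ℓ.two_le x, hx.trans_eq Nat.cast_zero]
    | succ k ih =>
      intro a c x ha hc hx
      obtain ⟨b, hab, hb⟩ := hY.exists_forall_mem_waypoints ℓ (hB a ha).1
      have least : HasLeastAbove Y.Reaches (insert b B) a :=
        ⟨b, ℓ.isLeastAbove_of_forall_mem_waypoints (B.mem_insert b) hab hb⟩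
      refine least.of_subset (B.subset_insert b) fun d hd hdB => ?_
      obtain rfl := hd.resolve_right hdB
      obtain rfl | ⟨-, z, hz⟩ := hb c x
      · exact absurd hc hdB
      · exact ih d c z hdB hc (by push_cast at hx; linarith)
  obtain ⟨b, hbB, ⟨x⟩⟩ := (hB a ha).2
  obtain ⟨k, hk⟩ := exists_nat_gt (ℓ x)
  exact of_length_lt k a b x ha hbB hk

end Branching

/-! ### Invariance of rigid cores -/

section Invariance

variable {X Y : PathFlow.{u}} {f : X ⟶ Y} {ι : Type*} {r : ι → ι → Prop}

/-- The embedding of reachability relations defined by a morphism that is injective on states and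
reflects the existence of paths. -/
def reachesEmbedding (f : X ⟶ Y) (hf : Function.Injective (Hom.state f))
    (h : ∀ a b, Y.Reaches (Hom.state f a) (Hom.state f b) → X.Reaches a b) :
    X.Reaches ↪r Y.Reaches where
  toFun := Hom.state f
  inj' := hf
  map_rel_iff' := ⟨h _ _, fun ⟨x⟩ => ⟨Hom.path f x⟩⟩

theorem reaches_of_leftInverse {g : Y ⟶ X}
    (h : Function.LeftInverse (Hom.state g) (Hom.state f)) (a b : X.State)
    (hab : Y.Reaches (Hom.state f a) (Hom.state f b)) : X.Reaches a b := by
  have hgf : X.Reaches (Hom.state g (Hom.state f a)) (Hom.state g (Hom.state f b)) :=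
    hab.map (Hom.path g)
  rwa [h a, h b] at hgf

theorem SHomotopic.state_eq {g : X ⟶ Y} (h : SHomotopic f g) (a : X.State) :
    Hom.state f a = Hom.state g a := by
  obtain ⟨H, -, rfl, hs, -⟩ := h
  exact (hs 1 a).symm

theorem IsSHomotopyEquiv.nonempty_relIso (h : IsSHomotopyEquiv f) :
    Nonempty (X.Reaches ≃r Y.Reaches) := by
  obtain ⟨g, hgf, hfg⟩ := h
  have left_inv : Function.LeftInverse (Hom.state g) (Hom.state f) := hgf.state_eq
  have right_inv : Function.RightInverse (Hom.state g) (Hom.state f) := hfg.state_eq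
  exact ⟨.ofSurjective (reachesEmbedding f left_inv.injective (reaches_of_leftInverse left_inv))
    right_inv.surjective⟩

theorem IsWeakSHomotopyEquiv.nonempty_relIso (h : IsWeakSHomotopyEquiv f) :
    Nonempty (X.Reaches ≃r Y.Reaches) := by
  obtain ⟨hbij, ⟨-, hsurj⟩, -⟩ := h
  refine ⟨.ofSurjective (reachesEmbedding f hbij.1 ?_) hbij.2⟩
  rintro a b ⟨y⟩
  obtain ⟨q, hq⟩ := hsurj (Quotient.mk _ ⟨(Hom.state f a, Hom.state f b), y⟩)
  obtain ⟨⟨⟨c, d⟩, x⟩, rfl⟩ := Quotient.exists_rep q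
  have endpoints : (Hom.state f c, Hom.state f d) = (Hom.state f a, Hom.state f b) :=
    fst_eq_of_joined (Quotient.exact hq)
  obtain rfl := hbij.1 (congrArg Prod.fst endpoints)
  obtain rfl := hbij.1 (congrArg Prod.snd endpoints)
  exact ⟨x⟩

theorem IsTHomotopyEquiv.exists_relEmbedding (h : IsTHomotopyEquiv f) :
    ∃ e : X.Reaches ↪r Y.Reaches, ⇑e = Hom.state f := by
  obtain ⟨g, hg, -⟩ := h.isIso
  have left_inv : Function.LeftInverse (Hom.state g) (Hom.state (Hom.toRestrict f)) :=
    congrFun (congrArg (fun k => Hom.state k) hg)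
  exact ⟨reachesEmbedding f (Subtype.val_injective.comp left_inv.injective)
    (reaches_of_leftInverse (f := Hom.toRestrict f) left_inv), rfl⟩

theorem IsTHomotopyEquiv.hasCore_iff (h : IsTHomotopyEquiv f) (hY : Y.IsCofibrant)
    (hr : IsRigid r) : HasCore X.Reaches r ↔ HasCore Y.Reaches r := by
  obtain ⟨e, he⟩ := h.exists_relEmbedding
  have branching : ∀ a ∉ Set.range e, Nonempty (Unique (Y.BranchingSpace a)) ∧
      ∃ b ∈ Set.range e, Y.Reaches a b :=
    he ▸ fun a ha => ⟨h.branching a ha, ((h.surrounded a trivial).resolve_left ha).2⟩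
  have merging : ∀ a ∉ Set.range e, Nonempty (Unique (Y.op.BranchingSpace a)) ∧
      ∃ b ∈ Set.range e, Y.op.Reaches a b :=
    he ▸ fun a ha => ⟨h.merging a ha, ((h.surrounded a trivial).resolve_left ha).1⟩
  exact ⟨fun hX => hX.map e (fun _ => hY.hasLeastAbove branching)
      (fun _ => hY.op.hasLeastAbove merging),
    fun hY' => hY'.of_relEmbedding hr e (fun a ha => hY.hasLeastAbove_univ (branching a ha).1)
      (fun a ha => hY.op.hasLeastAbove_univ (merging a ha).1)⟩

theorem hasCore_iff (h : IsSHomotopyEquiv f ∨ IsTHomotopyEquiv f) (hY : Y.IsCofibrant)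
    (hr : IsRigid r) : HasCore X.Reaches r ↔ HasCore Y.Reaches r := by
  rcases h with h | h
  · obtain ⟨e⟩ := h.nonempty_relIso
    exact ⟨fun hX => hX.congr e, fun hY => hY.congr e.symm⟩
  · exact h.hasCore_iff hY hr

end Invariance

/-! ### The states of the cube -/

section Cube

variable {X Y : PathFlow.{u}}

theorem tensor_reaches_iff {a c : X.State} {b d : Y.State} :
    (tensor X Y).Reaches (a, b) (c, d) ↔
      X.Reaches a c ∧ Y.Reaches b d ∨ a = c ∧ Y.Reaches b d ∨ b = d ∧ X.Reaches a c := by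
  constructor
  · rintro ⟨x | ⟨⟨h⟩, y⟩ | ⟨⟨h⟩, x⟩⟩
    · exact .inl ⟨⟨x.fst⟩, ⟨x.snd⟩⟩
    · exact .inr (.inl ⟨h, ⟨y⟩⟩)
    · exact .inr (.inr ⟨h, ⟨x⟩⟩)
  · rintro (⟨⟨x⟩, ⟨y⟩⟩ | ⟨h, ⟨y⟩⟩ | ⟨h, ⟨x⟩⟩)
    · exact ⟨.inl ⟨x, y⟩⟩
    · exact ⟨.inr (.inl ⟨⟨h⟩, y⟩)⟩
    · exact ⟨.inr (.inr ⟨⟨h⟩, x⟩)⟩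

/-- The states of a tensor product are ordered componentwise. -/
def tensorReachesIso {α β : Type*} [PartialOrder α] [PartialOrder β]
    (e : X.Reaches ≃r ((· < ·) : α → α → Prop)) (f : Y.Reaches ≃r ((· < ·) : β → β → Prop)) :
    (tensor X Y).Reaches ≃r ((· < ·) : α × β → α × β → Prop) where
  toEquiv := e.toEquiv.prodCongr f.toEquiv
  map_rel_iff' := by
    rintro ⟨a, b⟩ ⟨c, d⟩
    rw [tensor_reaches_iff]
    change (e a, f b) < (e c, f d) ↔ _
    simp only [Prod.mk_lt_mk, le_iff_lt_or_eq, e.map_rel_iff, f.map_rel_iff,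
      EmbeddingLike.apply_eq_iff_eq]
    tauto

/-- The two states of the directed segment are ordered as `false < true`. -/
def segmentReachesIso : segment.{u}.Reaches ≃r ((· < ·) : Bool → Bool → Prop) where
  toFun
    | .bot => false
    | .top => true
  invFun
    | false => .bot
    | true => .top
  left_inv := by rintro (_ | _) <;> rfl
  right_inv := by rintro (_ | _) <;> rfl
  map_rel_iff' := by
    rintro (_ | _) (_ | _)
    · exact iff_of_false (lt_irrefl _) fun ⟨x⟩ => PEmpty.elim x
    · exact iff_of_true Bool.false_lt_true ⟨PUnit.unit⟩
    · exact iff_of_false (by decide) fun ⟨x⟩ => PEmpty.elim x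
    · exact iff_of_false (lt_irrefl _) fun ⟨x⟩ => PEmpty.elim x

/-- The states of the `n`-cube are ordered as the Boolean lattice with `n` atoms. -/
def segmentPowReachesIso :
    ∀ n, (segmentPow.{u} n).Reaches ≃r ((· < ·) : (Fin n → Bool) → (Fin n → Bool) → Prop)
  | 0 => {
      toEquiv := .ofUnique PUnit (Fin 0 → Bool)
      map_rel_iff' := iff_of_false (fun h => h.ne (Subsingleton.elim _ _))
        fun ⟨x⟩ => PEmpty.elim x }
  | n + 1 => (tensorReachesIso (segmentPowReachesIso n) segmentReachesIso).trans
      (OrderIso.prodComm.trans (Fin.snocOrderIso fun _ => Bool)).toRelIsoLT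

theorem hasCore_lt_of_isWeakSHomotopyEquiv {n : ℕ} {p : X ⟶ segmentPow n}
    (hp : IsWeakSHomotopyEquiv p) :
    HasCore X.Reaches ((· < ·) : (Fin n → Bool) → (Fin n → Bool) → Prop) := by
  obtain ⟨e⟩ := hp.nonempty_relIso
  exact (HasCore.refl _).congr (e.trans (segmentPowReachesIso n)).symm

theorem isRigid_lt_fin {n : ℕ} (hn : 3 ≤ n) :
    IsRigid ((· < ·) : (Fin n → Bool) → (Fin n → Bool) → Prop) := by
  refine isRigid_lt ?_
  calc (4 : ℕ∞) < 2 ^ 3 := by norm_num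
    _ ≤ 2 ^ n := pow_le_pow_right₀ one_le_two hn
    _ = ENat.card (Fin n → Bool) := by simp

theorem enatCard_state_segment : ENat.card segment.{u}.State = 2 := by
  rw [ENat.card_congr segmentReachesIso.toEquiv]
  simp

end Cube

theorem hasCore_of_zigzag {ι : Type*} {r : ι → ι → Prop} (hr : IsRigid r) {m : ℕ}
    {X : ℕ → PathFlow.{u}} (h₀ : HasCore (X 0).Reaches r)
    (hX : ∀ i < m, (X (2 * i + 1)).IsCofibrant)
    (hzig : ∀ i < m,
      (∃ f : X (2 * i) ⟶ X (2 * i + 1), IsSHomotopyEquiv f ∨ IsTHomotopyEquiv f) ∧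
      (∃ f : X (2 * i + 2) ⟶ X (2 * i + 1), IsSHomotopyEquiv f ∨ IsTHomotopyEquiv f)) :
    HasCore (X (2 * m)).Reaches r := by
  induction m with
  | zero => exact h₀
  | succ m ih =>
    have hm := ih (fun i hi => hX i (hi.trans m.lt_succ_self))
      fun i hi => hzig i (hi.trans m.lt_succ_self)
    have hY := hX m m.lt_succ_self
    obtain ⟨⟨f, hf⟩, g, hg⟩ := hzig m m.lt_succ_self
    exact (hasCore_iff hg hY hr).2 ((hasCore_iff hf hY hr).1 hm)

end PathFlow

open PathFlow in
theorem mainTheorem1_general {n : ℕ} (hn : 3 ≤ n) {m : ℕ} {X : ℕ → PathFlow.{u}}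
    {p : X 0 ⟶ segmentPow n} (hp : IsWeakSHomotopyEquiv p)
    (hX : ∀ i < m, (X (2 * i + 1)).IsCofibrant)
    (hzig : ∀ i < m,
      (∃ f : X (2 * i) ⟶ X (2 * i + 1), IsSHomotopyEquiv f ∨ IsTHomotopyEquiv f) ∧
      (∃ f : X (2 * i + 2) ⟶ X (2 * i + 1), IsSHomotopyEquiv f ∨ IsTHomotopyEquiv f)) :
    2 ^ n ≤ ENat.card (X (2 * m)).State := by
  have hcore := hasCore_of_zigzag (isRigid_lt_fin hn) (hasCore_lt_of_isWeakSHomotopyEquiv hp) hX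
    hzig
  simpa using hcore.card_le

theorem mainTheorem1 (n : ℕ) (hn : 3 ≤ n) (C : PathFlow.{u})
    (hC : C.IsCofibrantReplacement (PathFlow.segmentPow n)) :
    ¬ ∃ (m : ℕ) (X : ℕ → PathFlow.{u}), X 0 = C ∧ X (2 * m) = PathFlow.segment ∧
      (∀ i ≤ 2 * m, (X i).IsCell) ∧
      ∀ i < m,
        (∃ f : X (2 * i) ⟶ X (2 * i + 1),
          PathFlow.IsSHomotopyEquiv f ∨ PathFlow.IsTHomotopyEquiv f) ∧
        (∃ f : X (2 * i + 2) ⟶ X (2 * i + 1),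
          PathFlow.IsSHomotopyEquiv f ∨ PathFlow.IsTHomotopyEquiv f) := by
  rintro ⟨m, X, rfl, hm, hcell, hzig⟩
  obtain ⟨-, p, hp⟩ := hC
  have card_le := mainTheorem1_general hn hp (fun i hi => (hcell _ (by lia)).isCofibrant) hzig
  rw [hm, PathFlow.enatCard_state_segment] at card_le
  exact absurd ((pow_le_pow_right₀ one_le_two hn).trans card_le) (by norm_num)
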